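/- Let $T>0$, let $W=(W_t)_{t\in[0,T]}$ be a standard Brownian motion on a probability space $(\Omega,\mathcal{F},\mathbb{P})$, and write $\int_0^T f(s)\,dW_s$ for the Wiener integral of $f\in L^2([0,T])$, i.e. the image of $f$ under the linear isometry $L^2([0,T])\to L^2(\Omega)$ that extends $\mathbf{1}_{[0,t]}\mapsto W_t$. Let $X=(X_t)_{t\in[0,T]}$ be a centered Gaussian process with $\sup_{t\in[0,T]}\mathbb{E}[X_t^2]<\infty$, and let $K\in L^2([0,T]^2)$ be a Volterra kernel, i.e. $K(t,s)=0$ for $s>t$, with $K(t,\cdot)\in L^2([0,T])$ for every $t\in[0,T]$, such that $$X_t=\int_0^t K(t,s)\,dW_s\quad\text{almost surely, for every } t\in[0,T].$$ Assume moreover that $H^X_T=H^W_T$, where $H^X_T$ (resp. $H^W_T$) is the closure in $L^2(\Omega)$ of the linear span of $\{X_s: s\in[0,T]\}$ (resp. $\{W_s: s\in[0,T]\}$). Let $n\ge 1$ and $$0\le t_L^1<t_U^1<t_L^2<t_U^2<\cdots<t_L^n<t_U^n\le T,\qquad t_U^0:=0,$$ and put $\Delta=[t_L^1,t_U^1]\cup\cdots\cup[t_L^n,t_U^n]$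 and $\mathcal{F}_\Delta=\sigma(X_s: s\in\Delta)$. Then for each $t\in[0,T]\setminus\Delta$ there is a function $f_t\in L^2([0,T])$ such that, almost surely, $$\mathbb{E}[X_t\mid\mathcal{F}_\Delta]=\int_0^T f_t(s)\,dW_s ,$$ and $f_t$ solves the following recursive system of Volterra integral equations of the first kind: for each $k=1,\dots,n$ and every $u_k\in[t_L^k,t_U^k]$, $$\int_{t_L^k}^{u_k}\bigl[f_t(s)-K(t,s)\bigr]K(u_k,s)\,ds=\int_0^{t_L^k}\bigl[K(t,s)-f_t(s)\bigr]K(u_k,s)\,ds,$$ with the boundary conditions, for each $k=1,\dots,n$, $$\int_{t_U^{k-1}}^{t_L^k}f_t(s)K(t_L^k,s)\,ds=\int_0^{t_L^k}K(t,s)K(t_L^k,s)\,ds-\int_0^{t_U^{k-1}}f_t(s)K(t_L^k,s)\,ds.$$ -/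

import Mathlib

open MeasureTheory ProbabilityTheory Set
open scoped ENNReal

noncomputable section

namespace VolterraPrediction

variable {Ω : Type*} [mΩ : MeasurableSpace Ω]

/-- Lebesgue measure on the interval `[0,T]`. -/
def lebT (T : ℝ) : Measure ℝ := (volume : Measure ℝ).restrict (Icc 0 T)

instance (T : ℝ) : IsFiniteMeasure (lebT T) := by
  unfold lebT; infer_instance

/-- A standard Brownian motion on the time interval `[0,T]` (values of `W` at other times play
no role): a centered Gaussian process with covariance `min s t` and almost surely continuous
paths. -/
structure IsBrownianMotionOn (T : ℝ) (W : ℝ → Ω → ℝ) (P : Measure Ω) : Prop where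
  gaussian : IsGaussianProcess (fun t : Icc (0 : ℝ) T => W t) P
  centered : ∀ t ∈ Icc (0 : ℝ) T, ∫ ω, W t ω ∂P = 0
  covariance : ∀ s ∈ Icc (0 : ℝ) T, ∀ t ∈ Icc (0 : ℝ) T, cov[W s, W t; P] = min s t
  continuous : ∀ᵐ ω ∂P, ContinuousOn (fun t => W t ω) (Icc 0 T)

theorem IsBrownianMotionOn.memLp {T : ℝ} {W : ℝ → Ω → ℝ} {P : Measure Ω}
    (hW : IsBrownianMotionOn T W P) (t : Icc (0 : ℝ) T) : MemLp (W t) 2 P :=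
  (hW.gaussian.hasGaussianLaw_eval t).memLp_two

/-- A finite formal combination `∑ aᵢ · tᵢ` with `tᵢ ∈ [0,T]` is sent to the step function
`∑ aᵢ 1_{[0,tᵢ]}` of `L²([0,T])`. -/
def stepMap (T : ℝ) : (Icc (0 : ℝ) T →₀ ℝ) →ₗ[ℝ] Lp ℝ 2 (lebT T) :=
  Finsupp.linearCombination ℝ fun t : Icc (0 : ℝ) T =>
    indicatorConstLp 2 (μ := lebT T) (measurableSet_Icc (a := (0 : ℝ)) (b := (t : ℝ)))
      (measure_ne_top _ _) (1 : ℝ)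

/-- A finite formal combination `∑ aᵢ · tᵢ` with `tᵢ ∈ [0,T]` is sent to the random variable
`∑ aᵢ W_{tᵢ}` of `L²(Ω)`. -/
def brownianMap {T : ℝ} {W : ℝ → Ω → ℝ} {P : Measure Ω} (hW : IsBrownianMotionOn T W P) :
    (Icc (0 : ℝ) T →₀ ℝ) →ₗ[ℝ] Lp ℝ 2 P :=
  Finsupp.linearCombination ℝ fun t : Icc (0 : ℝ) T => (hW.memLp t).toLp (W t)

/-- The **Wiener integral** `f ↦ ∫₀ᵀ f(s) dW_s`: the continuous linear map
`L²([0,T]) → L²(Ω)` which extends `1_{[0,t]} ↦ W_t`. -/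
def wienerIntegral {T : ℝ} {W : ℝ → Ω → ℝ} {P : Measure Ω} (hW : IsBrownianMotionOn T W P) :
    Lp ℝ 2 (lebT T) →L[ℝ] Lp ℝ 2 P :=
  (brownianMap hW).extendOfNorm (stepMap T)

theorem denseRange_stepMap (T : ℝ) : DenseRange (stepMap T) := by
  have key : (LinearMap.range (stepMap T)).topologicalClosure = ⊤ := by
    rw [Submodule.topologicalClosure_eq_top_iff, Submodule.eq_bot_iff]
    intro g hg
    have h0 : ∀ t ∈ Icc (0 : ℝ) T, ∫ x in Icc 0 t, g x ∂(lebT T) = 0 := by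
      intro t ht
      have h1 := (Submodule.mem_orthogonal _ _).1 hg (stepMap T (Finsupp.single ⟨t, ht⟩ 1))
        (LinearMap.mem_range_self _ _)
      simp only [stepMap, Finsupp.linearCombination_single, one_smul] at h1
      rwa [L2.inner_indicatorConstLp_one] at h1
    have hint : Integrable g (lebT T) := (Lp.memLp g).integrable (by norm_num)
    have hIic : ∀ a : ℝ, ∫ x in Iic a, g x ∂(lebT T) = 0 := by
      intro a
      rcases lt_or_ge T 0 with hT | hT
      · simp [lebT, Icc_eq_empty (not_le.2 hT)]
      rcases lt_or_ge a 0 with ha | ha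
      · have : (lebT T) (Iic a) = 0 := by
          rw [lebT, Measure.restrict_apply measurableSet_Iic]
          have : Iic a ∩ Icc 0 T = ∅ := by
            ext x; simp only [mem_inter_iff, mem_Iic, mem_Icc, mem_empty_iff_false]; grind
          simp [this]
        rw [Measure.restrict_eq_zero.2 this, integral_zero_measure]
      · have h2 := h0 (min a T) ⟨le_min ha hT, min_le_right _ _⟩
        have h3 : (lebT T).restrict (Iic a) = (lebT T).restrict (Icc 0 (min a T)) := by
          rw [lebT, Measure.restrict_restrict measurableSet_Iic,
            Measure.restrict_restrict measurableSet_Icc]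
          congr 1
          ext x; simp only [mem_inter_iff, mem_Iic, mem_Icc, le_min_iff]; grind
        rw [h3, h2]
    have hall : ∀ s, MeasurableSet s → ∫ x in s, g x ∂(lebT T) = 0 := by
      have huniv : ∫ x, g x ∂(lebT T) = 0 := by
        have h3 : (lebT T).restrict (Iic T) = lebT T := by
          rw [lebT, Measure.restrict_restrict measurableSet_Iic]
          congr 1
          ext x; simp only [mem_inter_iff, mem_Iic, mem_Icc]; grind
        have h4 := hIic T
        rwa [h3] at h4
      intro s hs
      refine MeasurableSpace.induction_on_inter
        (C := fun s _ => ∫ x in s, g x ∂(lebT T) = 0) (borel_eq_generateFrom_Iic ℝ ▸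
          (BorelSpace.measurable_eq (α := ℝ))) isPiSystem_Iic (by simp) ?_ ?_ ?_ s hs
      · rintro _ ⟨a, rfl⟩; exact hIic a
      · intro t ht h
        have := integral_add_compl ht hint
        rw [h, huniv, zero_add] at this
        exact this
      · intro f hd hm h
        rw [integral_iUnion hm hd hint.integrableOn]
        simp [h]
    refine (Lp.eq_zero_iff_ae_eq_zero).2 ?_
    exact hint.ae_eq_zero_of_forall_setIntegral_eq_zero fun s hs _ => hall s hs
  have := (Submodule.dense_iff_topologicalClosure_eq_top).2 key
  rwa [LinearMap.coe_range] at this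

theorem norm_brownianMap {T : ℝ} {W : ℝ → Ω → ℝ} {P : Measure Ω}
    (hW : IsBrownianMotionOn T W P) (x : Icc (0 : ℝ) T →₀ ℝ) :
    ‖brownianMap hW x‖ = ‖stepMap T x‖ := by
  have hP : IsProbabilityMeasure P := hW.gaussian.isProbabilityMeasure
  have key : ∀ s t : Icc (0 : ℝ) T,
      inner ℝ ((hW.memLp s).toLp (W s)) ((hW.memLp t).toLp (W t)) =
      inner ℝ
        (indicatorConstLp 2 (μ := lebT T) (measurableSet_Icc (a := (0 : ℝ)) (b := (s : ℝ)))
          (measure_ne_top _ _) (1 : ℝ))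
        (indicatorConstLp 2 (μ := lebT T) (measurableSet_Icc (a := (0 : ℝ)) (b := (t : ℝ)))
          (measure_ne_top _ _) (1 : ℝ)) := by
    intro s t
    have hl : inner ℝ ((hW.memLp s).toLp (W s)) ((hW.memLp t).toLp (W t)) =
        min (s : ℝ) t := by
      rw [← hW.covariance s s.2 t t.2, covariance_eq_sub (hW.memLp s) (hW.memLp t),
        hW.centered s s.2, zero_mul, sub_zero, L2.inner_def]
      refine integral_congr_ae ?_
      filter_upwards [(hW.memLp s).coeFn_toLp, (hW.memLp t).coeFn_toLp] with ω h1 h2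
      simp [h1, h2, mul_comm]
    rw [hl, L2.inner_indicatorConstLp_indicatorConstLp]
    have : (lebT T) (Icc 0 (s : ℝ) ∩ Icc 0 (t : ℝ)) = ENNReal.ofReal (min (s : ℝ) t) := by
      rw [lebT, Measure.restrict_apply (measurableSet_Icc.inter measurableSet_Icc),
        Icc_inter_Icc, Icc_inter_Icc]
      have hs := s.2.2
      have : min (min (s : ℝ) t) T = min (s : ℝ) t := min_eq_left (le_trans (min_le_left _ _) hs)
      simp [this]
    rw [Measure.real, this, ENNReal.toReal_ofReal (le_min s.2.1 t.2.1)]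
    simp
  have hin : inner ℝ (brownianMap hW x) (brownianMap hW x) =
      inner ℝ (stepMap T x) (stepMap T x) := by
    simp only [brownianMap, stepMap, Finsupp.linearCombination_apply, Finsupp.sum, sum_inner,
      inner_sum, real_inner_smul_left, real_inner_smul_right, key]
  rw [real_inner_self_eq_norm_sq, real_inner_self_eq_norm_sq] at hin
  exact (sq_eq_sq₀ (norm_nonneg _) (norm_nonneg _)).1 hin

/-- The Wiener integral of `1_{[0,t]}` is `W_t`. -/
theorem wienerIntegral_indicator {T : ℝ} {W : ℝ → Ω → ℝ} {P : Measure Ω}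
    (hW : IsBrownianMotionOn T W P) (t : Icc (0 : ℝ) T) :
    wienerIntegral hW
      (indicatorConstLp 2 (μ := lebT T) (measurableSet_Icc (a := (0 : ℝ)) (b := (t : ℝ)))
        (measure_ne_top _ _) (1 : ℝ)) = (hW.memLp t).toLp (W t) := by
  have := LinearMap.extendOfNorm_eq (f := brownianMap hW) (denseRange_stepMap T)
    ⟨1, fun x => by rw [one_mul, norm_brownianMap hW]⟩ (Finsupp.single t 1)
  simpa [wienerIntegral, stepMap, brownianMap] using this

/-- The Wiener integral is an isometry. -/
theorem norm_wienerIntegral {T : ℝ} {W : ℝ → Ω → ℝ} {P : Measure Ω}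
    (hW : IsBrownianMotionOn T W P) (f : Lp ℝ 2 (lebT T)) : ‖wienerIntegral hW f‖ = ‖f‖ := by
  refine (denseRange_stepMap T).induction_on f (isClosed_eq (by fun_prop) (by fun_prop)) ?_
  intro x
  rw [wienerIntegral, LinearMap.extendOfNorm_eq (denseRange_stepMap T)
    ⟨1, fun x => by rw [one_mul, norm_brownianMap hW]⟩, norm_brownianMap hW]

/-- The first chaos `H^X_t`: the closure in `L²(Ω)` of the linear span of the random variables
`X_s`, `s ∈ [0,t]`. -/
def firstChaos (X : ℝ → Ω → ℝ) (P : Measure Ω) (t : ℝ) : Submodule ℝ (Lp ℝ 2 P) :=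
  (Submodule.span ℝ {ξ : Lp ℝ 2 P | ∃ s ∈ Icc (0 : ℝ) t, ξ =ᵐ[P] X s}).topologicalClosure

/-- `X` is a centered Gaussian process on `[0,T]` with bounded variance, which is driven by the
Brownian motion `W` through the square integrable kernel `K`, that is
`X_t = ∫₀ᵀ K(t,s) dW_s` almost surely for every `t ∈ [0,T]`, and `H^X_T = H^W_T`. -/
structure IsFredholmGaussian (T : ℝ) (X W : ℝ → Ω → ℝ) (K : ℝ → ℝ → ℝ) (P : Measure Ω)
    (hW : IsBrownianMotionOn T W P) : Prop where
  measurable : ∀ t ∈ Icc (0 : ℝ) T, Measurable (X t)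
  gaussian : IsGaussianProcess (fun t : Icc (0 : ℝ) T => X t) P
  centered : ∀ t ∈ Icc (0 : ℝ) T, ∫ ω, X t ω ∂P = 0
  bddVariance : BddAbove ((fun t => ∫ ω, X t ω ^ 2 ∂P) '' Icc (0 : ℝ) T)
  kernel_memLp : MemLp (fun p : ℝ × ℝ => K p.1 p.2) 2 ((lebT T).prod (lebT T))
  representation : ∀ t ∈ Icc (0 : ℝ) T, ∃ hK : MemLp (K t) 2 (lebT T),
    X t =ᵐ[P] wienerIntegral hW (hK.toLp (K t))
  chaos_eq : firstChaos X P T = firstChaos W P T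

/-- `K` is of Volterra type on `[0,T]`: `K(t,s) = 0` for `s > t`. For such a kernel
`∫₀ᵀ K(t,s) dW_s` is `∫₀ᵗ K(t,s) dW_s`. -/
def IsVolterraKernel (T : ℝ) (K : ℝ → ℝ → ℝ) : Prop :=
  ∀ t ∈ Icc (0 : ℝ) T, ∀ s ∈ Icc (0 : ℝ) T, t < s → K t s = 0

/-- The endpoints of the `n ≥ 1` observed intervals satisfy
`0 ≤ tL 1 < tU 1 < tL 2 < tU 2 < ⋯ < tL n < tU n ≤ T`, with the convention `tU 0 = 0`.
The values of `tL` and `tU` at other indices play no role. -/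
structure IsObservationGrid (T : ℝ) (n : ℕ) (tL tU : ℕ → ℝ) : Prop where
  one_le : 1 ≤ n
  tU_zero : tU 0 = 0
  nonneg : 0 ≤ tL 1
  tL_lt_tU : ∀ k ∈ Finset.Icc 1 n, tL k < tU k
  tU_lt_tL : ∀ k ∈ Finset.Ico 1 n, tU k < tL (k + 1)
  le_T : tU n ≤ T

/-- The observed set `Δ = [tL 1, tU 1] ∪ ⋯ ∪ [tL n, tU n]`. -/
def observedSet (n : ℕ) (tL tU : ℕ → ℝ) : Set ℝ :=
  ⋃ k ∈ Finset.Icc 1 n, Icc (tL k) (tU k)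

/-- The σ-algebra `σ(X_t : t ∈ D)`. -/
abbrev sigmaOf (X : ℝ → Ω → ℝ) (D : Set ℝ) : MeasurableSpace Ω :=
  ⨆ t ∈ D, MeasurableSpace.comap (X t) inferInstance

end VolterraPrediction

end

/-! For jointly Gaussian centered variables, conditional expectation is linear: the prediction of `X
t` is its orthogonal projection onto the closed span of the observed `X u`
(`condExp_ae_eq_starProjection`). The mechanism is that a residual uncorrelated with finitely many
observations is independent of them (`setIntegral_residual_eq_zero`); infinitely many observations
are reached as a limit over finite subfamilies.

Each observed `X u` is a Wiener integral, and the Wiener integral is an isometry with closed range,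
so the projection is again the Wiener integral of some `f`. Orthogonality of the residual to `X u`
then becomes `∫₀ᵀ (K t s - f s) K u s ds = 0` for every observed `u`. The Volterra property cuts
this integral at `u`. Splitting it at `tL k` gives the integral equation; the case `u = tL k`, split
at `tU (k - 1)`, gives the boundary condition. -/

namespace VolterraPrediction

/-! ### Conditioning in Gaussian families -/

/-- A linear residual of a centered Gaussian family which is orthogonal to finitely many members
of the family integrates to zero over the events these members generate. -/
theorem setIntegral_residual_eq_zero {Ω ι : Type*} [mΩ : MeasurableSpace Ω] {P : Measure Ω}
    {Y : Ω → ℝ} {X : ι → Ω → ℝ}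
    (hG : IsGaussianProcess (fun o : Option ι => o.elim Y X) P)
    (hYm : Measurable Y) (hXm : ∀ i, Measurable (X i))
    (hY0 : ∫ ω, Y ω ∂P = 0) (hX0 : ∀ i, ∫ ω, X i ω ∂P = 0) (F : Finset ι) (c : ι → ℝ)
    (horth : ∀ i ∈ F, ∫ ω, (Y ω - ∑ j ∈ F, c j * X j ω) * X i ω ∂P = 0)
    {A : Set Ω}
    (hA : MeasurableSet[MeasurableSpace.comap (fun ω (i : F) => X i ω) inferInstance] A) :
    ∫ ω in A, (Y ω - ∑ j ∈ F, c j * X j ω) ∂P = 0 := by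
  classical
  have hP : IsProbabilityMeasure P := hG.isProbabilityMeasure
  have hYL : MemLp Y 2 P := (hG.hasGaussianLaw_eval none).memLp_two
  have hXL : ∀ i, MemLp (X i) 2 P := fun i => (hG.hasGaussianLaw_eval (some i)).memLp_two
  set Z : Ω → ℝ := fun ω => Y ω - ∑ j ∈ F, c j * X j ω with hZ
  have hSL : MemLp (fun ω => ∑ j ∈ F, c j * X j ω) 2 P :=
    memLp_finsetSum _ fun j _ => (hXL j).const_mul (c j)
  have hZL : MemLp Z 2 P := hYL.sub hSL
  have hZm : Measurable Z := hYm.sub (Finset.measurable_sum _ fun j _ => (hXm j).const_mul (c j))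
  have hZ0 : ∫ ω, Z ω ∂P = 0 := by
    rw [hZ, integral_sub (hYL.integrable (by norm_num)) (hSL.integrable (by norm_num)), hY0,
      integral_finsetSum _ fun j _ => ((hXL j).integrable (by norm_num)).const_mul (c j)]
    simp [integral_const_mul, hX0]
  have hjoint : IsGaussianProcess
      (Sum.elim (fun _ : Unit => Z) (fun i : F => X i)) P := by
    refine hG.of_isGaussianProcess ?_
    -- Joint Gaussianity holds because each variable is a continuous linear image of finitely many
    -- coordinates of the family: `Z` uses `none` and the indices in `F`, and `X i` is a single
    -- coordinate.
    rintro (_ | i)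
    · let G : Finset (Option ι) := insert none (F.image some)
      have hs : ∀ j ∈ F, some j ∈ G := fun j hj => by simp [G, hj]
      refine ⟨G, ContinuousLinearMap.proj ⟨none, by simp [G]⟩ -
        ∑ j : F, c j • ContinuousLinearMap.proj (R := ℝ) (φ := fun _ : G => ℝ)
          ⟨some j.1, hs j.1 j.2⟩, fun ω => ?_⟩
      simp [hZ, ← Finset.sum_coe_sort F]
    · exact ⟨{some i.1}, ContinuousLinearMap.proj ⟨some i.1, by simp⟩, fun ω => by simp⟩
  have hind : IndepFun (fun ω (_ : Unit) => Z ω) (fun ω (i : F) => X i ω) P := by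
    refine hjoint.indepFun_of_covariance_eq_zero (fun _ => hZm.aemeasurable)
      (fun i => (hXm i).aemeasurable) fun _ i => ?_
    rw [covariance_eq_sub hZL (hXL i), hX0, mul_zero, sub_zero]
    exact horth i i.2
  have hind' : IndepFun Z (fun ω (i : F) => X i ω) P :=
    hind.comp (φ := fun z : Unit → ℝ => z ()) (measurable_pi_apply _) measurable_id
  have hle : MeasurableSpace.comap (fun ω (i : F) => X i ω) inferInstance ≤ mΩ :=
    (measurable_pi_iff.2 fun i : F => hXm i).comap_le
  -- By independence the conditional expectation of `Z` is the constant `E[Z] = 0`, so its integral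
  -- over `A` vanishes.
  have hce := condExp_indep_eq hZm.comap_le hle
    (comap_measurable Z).stronglyMeasurable hind'
  rw [← setIntegral_condExp hle (hZL.integrable (by norm_num)) hA,
    setIntegral_congr_ae (g := fun _ => (0 : ℝ)) (hle _ hA), integral_zero]
  filter_upwards [hce] with ω h _
  rw [h, hZ0]

theorem inner_toLp {Ω : Type*} [MeasurableSpace Ω] {P : Measure Ω} {f g : Ω → ℝ}
    (hf : MemLp f 2 P) (hg : MemLp g 2 P) :
    inner ℝ (hf.toLp f) (hg.toLp g) = ∫ ω, f ω * g ω ∂P := by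
  rw [L2.inner_def]
  refine integral_congr_ae ?_
  filter_upwards [hf.coeFn_toLp, hg.coeFn_toLp] with ω h1 h2
  simp [h1, h2, mul_comm]

/-- For a centered Gaussian family, the conditional expectation given the family is the orthogonal
projection onto its closed linear span. -/
theorem condExp_ae_eq_starProjection {Ω ι : Type*} {m mΩ : MeasurableSpace Ω} {P : Measure Ω}
    {Y : Ω → ℝ} {X : ι → Ω → ℝ}
    (hG : IsGaussianProcess (fun o : Option ι => o.elim Y X) P)
    (hYm : Measurable Y) (hXm : ∀ i, Measurable (X i))
    (hY0 : ∫ ω, Y ω ∂P = 0) (hX0 : ∀ i, ∫ ω, X i ω ∂P = 0)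
    (hYL : MemLp Y 2 P) (hXL : ∀ i, MemLp (X i) 2 P)
    (hm : m = ⨆ i, MeasurableSpace.comap (X i) inferInstance) :
    P[Y | m] =ᵐ[P]
      (Submodule.span ℝ (range fun i => (hXL i).toLp (X i))).topologicalClosure.starProjection
        (hYL.toLp Y) := by
  classical
  have hP : IsProbabilityMeasure P := hG.isProbabilityMeasure
  set e : ι → Lp ℝ 2 P := fun i => (hXL i).toLp (X i) with he
  set y : Lp ℝ 2 P := hYL.toLp Y with hy
  have hle : m ≤ mΩ := hm.trans_le <| iSup_le fun i => (hXm i).comap_le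
  -- The finite spans increase to the whole span, so the projections onto them converge in `L²` to
  -- the projection onto its closure.
  let U : Finset ι → Submodule ℝ (Lp ℝ 2 P) := fun F => Submodule.span ℝ (e '' F)
  have hUfin : ∀ F, FiniteDimensional ℝ (U F) := fun F =>
    FiniteDimensional.span_of_finite ℝ (F.finite_toSet.image e)
  have hUproj : ∀ F, (U F).HasOrthogonalProjection := fun F => inferInstance
  have hUmono : Monotone U := fun F G h =>
    Submodule.span_mono (image_mono (Finset.coe_subset.2 h))
  have hUsup : ⨆ F, U F = Submodule.span ℝ (range e) := by
    rw [← Submodule.span_iUnion]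
    congr 1
    ext x
    simp only [mem_iUnion, mem_image, Finset.mem_coe, mem_range]
    exact ⟨fun ⟨_, i, _, h⟩ => ⟨i, h⟩, fun ⟨i, h⟩ => ⟨{i}, i, by simp, h⟩⟩
  have hlim := Submodule.starProjection_tendsto_closure_iSup U hUmono y
  rw [hUsup] at hlim
  set p := (Submodule.span ℝ (range e)).topologicalClosure.starProjection y with hp
  have hXmeas : ∀ i, Measurable[m] (X i) := fun i => (comap_measurable (X i)).mono
    ((le_iSup (fun i => MeasurableSpace.comap (X i) inferInstance) i).trans hm.ge) le_rfl
  -- These σ-algebras are directed, so their union is a π-system; it generates `m`.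
  let mF : Finset ι → MeasurableSpace Ω := fun F =>
    MeasurableSpace.comap (fun ω (i : F) => X i ω) inferInstance
  have hmFmono : Monotone mF := by
    intro F G h
    have : Measurable[mF G] (fun ω (i : F) => X i ω) := by
      refine @measurable_pi_iff _ _ _ (mF G) _ _ |>.2 fun i => ?_
      exact (measurable_pi_apply (X := fun _ : G => ℝ) ⟨i.1, h i.2⟩).comp
        (comap_measurable fun ω (i : G) => X i ω)
    exact this.comap_le
  have hmsup : m = ⨆ F, mF F := by
    apply le_antisymm
    · refine hm.trans_le <| iSup_le fun i => le_iSup_of_le {i} ?_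
      have : Measurable[mF {i}] (X i) :=
        (measurable_pi_apply (X := fun _ : ({i} : Finset ι) => ℝ) ⟨i, by simp⟩).comp
          (comap_measurable fun ω (j : ({i} : Finset ι)) => X j ω)
      exact this.comap_le
    · refine iSup_le fun F => ?_
      have : Measurable[m] (fun ω (i : F) => X i ω) := by
        refine @measurable_pi_iff _ _ _ m _ _ |>.2 fun i => ?_
        exact hXmeas i.1
      exact this.comap_le
  have hfin : ∀ F, ∀ A, MeasurableSet[mF F] A →
      ∫ ω in A, (y - (U F).starProjection y) ω ∂P = 0 := by
    intro F A hA
    obtain ⟨c, hc⟩ := (Submodule.mem_span_image_finset_iff_exists_fun' ℝ).1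
      ((U F).starProjection_apply_mem y)
    have hSL : MemLp (fun ω => ∑ j ∈ F, c j * X j ω) 2 P :=
      memLp_finsetSum _ fun j _ => (hXL j).const_mul (c j)
    have hsum : (U F).starProjection y = hSL.toLp _ := by
      rw [← hc]
      refine Lp.ext ?_
      refine (Lp.coeFn_finsetSum _ _).trans (Filter.EventuallyEq.trans ?_ hSL.coeFn_toLp.symm)
      have h1 : ∀ᵐ ω ∂P, ∀ j ∈ F, (c j • e j : Lp ℝ 2 P) ω = c j * X j ω := by
        refine (Finset.eventually_all F).2 fun j _ => ?_
        filter_upwards [Lp.coeFn_smul (c j) (e j), (hXL j).coeFn_toLp] with ω h2 h3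
        rw [h2, Pi.smul_apply, smul_eq_mul, he, h3]
      filter_upwards [h1] with ω h
      simp only [Finset.sum_apply]
      exact Finset.sum_congr rfl h
    have hres : y - (U F).starProjection y = (hYL.sub hSL).toLp _ := by
      rw [hsum, hy, ← MemLp.toLp_sub]
    have hae : ∫ ω in A, (y - (U F).starProjection y) ω ∂P =
        ∫ ω in A, (Y ω - ∑ j ∈ F, c j * X j ω) ∂P := by
      rw [hres]
      exact integral_congr_ae (ae_restrict_of_ae (hYL.sub hSL).coeFn_toLp)
    rw [hae]
    refine setIntegral_residual_eq_zero hG hYm hXm hY0 hX0 F c (fun i hi => ?_) hA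
    have h1 := Submodule.starProjection_inner_eq_zero (K := U F) y (e i)
      (Submodule.subset_span ⟨i, hi, rfl⟩)
    rw [hres, he, inner_toLp] at h1
    exact h1
  have hle' : ∀ F, mF F ≤ mΩ := fun F => ((le_iSup mF F).trans hmsup.ge).trans hle
  have hzero : ∀ A, MeasurableSet[m] A → ∫ ω in A, (y - p) ω ∂P = 0 := by
    intro A hA
    have hint : ∀ g : Lp ℝ 2 P, Integrable g P := fun g => (Lp.memLp g).integrable (by norm_num)
    have hpi : IsPiSystem (⋃ F, {A | MeasurableSet[mF F] A}) :=
      isPiSystem_iUnion_of_monotone _ (fun F => (mF F).isPiSystem_measurableSet)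
        fun F G h => hmFmono h
    have hbasic : ∀ F A, MeasurableSet[mF F] A → ∫ ω in A, (y - p) ω ∂P = 0 := by
      intro F A hA
      have hA' := hle' F A hA
      rw [← L2.inner_indicatorConstLp_one (𝕜 := ℝ) hA' (measure_ne_top _ _)]
      -- The integral over `A` is the inner product with `1_A`, hence continuous in `L²`. For every
      -- `G ⊇ F` the residual for `G` integrates to zero over `A`, and the limit along `G` inherits
      -- this.
      refine tendsto_nhds_unique
        ((tendsto_const_nhds (x := indicatorConstLp 2 hA' (measure_ne_top P _) (1 : ℝ))).inner
          (tendsto_const_nhds.sub hlim)) ?_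
      refine tendsto_const_nhds.congr' ?_
      filter_upwards [Filter.eventually_ge_atTop F] with G hG
      rw [L2.inner_indicatorConstLp_one, hfin G A (hmFmono hG A hA)]
    have huniv : ∫ ω, (y - p) ω ∂P = 0 := by
      simpa using hbasic ∅ univ (@MeasurableSet.univ _ (mF ∅))
    refine MeasurableSpace.induction_on_inter (m := m)
      (C := fun A _ => ∫ ω in A, (y - p) ω ∂P = 0)
      (hmsup.trans (MeasurableSpace.generateFrom_iUnion_measurableSet mF).symm) hpi
      (by simp) ?_ ?_ ?_ A hA
    · intro B hB
      obtain ⟨F, hF⟩ := mem_iUnion.1 hB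
      exact hbasic F B hF
    · intro B hB h
      have := integral_add_compl (hle _ hB) (hint (y - p))
      rwa [h, huniv, zero_add] at this
    · intro f hd hf h
      rw [integral_iUnion (fun i => hle _ (hf i)) hd (hint (y - p)).integrableOn]
      simp_rw [h, tsum_zero]
  have hpm : AEStronglyMeasurable[m] p P := by
    have hmem : p ∈ (Submodule.span ℝ (range e)).topologicalClosure :=
      Submodule.starProjection_apply_mem _ _
    -- The `m`-measurable elements form a closed subspace of `L²` containing every generator, so
    -- they contain the closed span and with it `p`.
    refine (Submodule.topologicalClosure_minimal (t := lpMeas ℝ ℝ m 2 P) _ ?_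
      (isClosed_aestronglyMeasurable hle)) hmem
    rw [Submodule.span_le]
    rintro _ ⟨i, rfl⟩
    refine mem_lpMeas_iff_aestronglyMeasurable.2 (AEStronglyMeasurable.congr ?_
      (hXL i).coeFn_toLp.symm)
    exact (hXmeas i).aestronglyMeasurable
  refine (ae_eq_condExp_of_forall_setIntegral_eq hle (hYL.integrable (by norm_num))
    (fun s _ _ => ((Lp.memLp p).integrable (by norm_num)).integrableOn) (fun s hs _ => ?_)
    hpm).symm
  have h1 := hzero s hs
  have h2 : ∫ ω in s, (y - p) ω ∂P = ∫ ω in s, Y ω ∂P - ∫ ω in s, p ω ∂P := by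
    rw [← integral_sub (hYL.integrable (by norm_num)).integrableOn
      ((Lp.memLp p).integrable (by norm_num)).integrableOn]
    refine integral_congr_ae (ae_restrict_of_ae ?_)
    filter_upwards [Lp.coeFn_sub y p, hYL.coeFn_toLp] with ω h3 h4
    rw [h3, Pi.sub_apply, hy, h4]
  linarith

/-! ### Order relations in the observation grid -/

theorem IsObservationGrid.zero_le_tU {T : ℝ} {n : ℕ} {tL tU : ℕ → ℝ}
    (h : IsObservationGrid T n tL tU) : ∀ k ≤ n, 0 ≤ tU k
  | 0, _ => h.tU_zero.ge
  | 1, hk => h.nonneg.trans (h.tL_lt_tU 1 (Finset.mem_Icc.2 ⟨le_rfl, hk⟩)).le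
  | k + 2, hk =>
    (h.zero_le_tU (k + 1) (by omega)).trans
      ((h.tU_lt_tL (k + 1) (Finset.mem_Ico.2 ⟨by omega, by omega⟩)).trans
        (h.tL_lt_tU (k + 2) (Finset.mem_Icc.2 ⟨by omega, hk⟩))).le

/-- For `k = 1` the convention `tU 0 = 0` reduces this to `0 ≤ tL 1`, where equality may occur; the
inequality is strict for larger `k`. -/
theorem IsObservationGrid.tU_pred_le_tL {T : ℝ} {n : ℕ} {tL tU : ℕ → ℝ}
    (h : IsObservationGrid T n tL tU) {k : ℕ} (hk : k ∈ Finset.Icc 1 n) :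
    tU (k - 1) ≤ tL k := by
  obtain ⟨h1, h2⟩ := Finset.mem_Icc.1 hk
  obtain ⟨j, rfl⟩ : ∃ j, k = j + 1 := ⟨k - 1, by omega⟩
  rcases Nat.eq_zero_or_pos j with rfl | hj
  · simpa [h.tU_zero] using h.nonneg
  · exact (h.tU_lt_tL j (Finset.mem_Ico.2 ⟨hj, by omega⟩)).le

theorem IsObservationGrid.tU_le {T : ℝ} {n : ℕ} {tL tU : ℕ → ℝ}
    (h : IsObservationGrid T n tL tU) {k : ℕ} (hk : k ∈ Finset.Icc 1 n) : tU k ≤ T := by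
  obtain ⟨h1, h2⟩ := Finset.mem_Icc.1 hk
  refine le_trans ?_ h.le_T
  refine Nat.le_induction (m := k) (P := fun j _ => j ≤ n → tU k ≤ tU j) (fun _ => le_rfl)
    (fun j hj ih hjn => (ih (by omega)).trans ?_) n h2 le_rfl
  exact (h.tU_lt_tL j (Finset.mem_Ico.2 ⟨by omega, by omega⟩)).le.trans
    (h.tL_lt_tU (j + 1) (Finset.mem_Icc.2 ⟨by omega, hjn⟩)).le

theorem IsObservationGrid.observedSet_subset {T : ℝ} {n : ℕ} {tL tU : ℕ → ℝ}
    (h : IsObservationGrid T n tL tU) : observedSet n tL tU ⊆ Icc 0 T := by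
  refine iUnion₂_subset fun k hk => Icc_subset_Icc ?_ (h.tU_le hk)
  exact (h.zero_le_tU (k - 1) (by have := Finset.mem_Icc.1 hk; omega)).trans (h.tU_pred_le_tL hk)

/-! ### Prediction as a Wiener integral -/

theorem inner_wienerIntegral {Ω : Type*} [MeasurableSpace Ω] {T : ℝ} {W : ℝ → Ω → ℝ}
    {P : Measure Ω} (hW : IsBrownianMotionOn T W P) (f g : Lp ℝ 2 (lebT T)) :
    inner ℝ (wienerIntegral hW f) (wienerIntegral hW g) = inner ℝ f g :=
  LinearIsometry.inner_map_map (𝕜 := ℝ)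
    ⟨(wienerIntegral hW : Lp ℝ 2 (lebT T) →ₗ[ℝ] Lp ℝ 2 P), norm_wienerIntegral hW⟩ f g

/-- An isometry from a complete space has closed range. Limits of Wiener integrals are therefore
Wiener integrals, which supplies the integrand of the prediction. -/
theorem isClosed_range_wienerIntegral {Ω : Type*} [MeasurableSpace Ω] {T : ℝ} {W : ℝ → Ω → ℝ}
    {P : Measure Ω} (hW : IsBrownianMotionOn T W P) :
    IsClosed ((wienerIntegral hW).range : Set (Lp ℝ 2 P)) :=
  (AddMonoidHomClass.isometry_of_norm (wienerIntegral hW)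
    (norm_wienerIntegral hW)).isClosedEmbedding.isClosed_range

/-- The conditional expectation of `X t` given `X s`, `s ∈ D`, is a Wiener integral whose integrand
differs from `K t` by a function orthogonal to every `K s`, `s ∈ D`. -/
theorem IsFredholmGaussian.exists_condExp_eq_wienerIntegral {Ω : Type*} [mΩ : MeasurableSpace Ω]
    {P : Measure Ω} {T : ℝ} {X W : ℝ → Ω → ℝ} {K : ℝ → ℝ → ℝ} {hW : IsBrownianMotionOn T W P}
    (hX : IsFredholmGaussian T X W K P hW) {D : Set ℝ} (hD : D ⊆ Icc 0 T) {t : ℝ}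
    (ht : t ∈ Icc 0 T) :
    ∃ (f : ℝ → ℝ) (hf : MemLp f 2 (lebT T)),
      P[X t | sigmaOf X D] =ᵐ[P] wienerIntegral hW (hf.toLp f) ∧
      ∀ u ∈ D, ∫ s, (K t s - f s) * K u s ∂(lebT T) = 0 := by
  have hL : ∀ s ∈ Icc (0 : ℝ) T, MemLp (X s) 2 P := fun s hs =>
    (hX.gaussian.hasGaussianLaw_eval ⟨s, hs⟩).memLp_two
  have hG : IsGaussianProcess (fun o : Option D => o.elim (X t) fun s : D => X s) P := by
    have h := hX.gaussian.comp_right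
      (fun o : Option D => o.elim (⟨t, ht⟩ : Icc (0 : ℝ) T) fun s => ⟨s, hD s.2⟩)
    exact h.congr fun o => by cases o <;> rfl
  have hrep : ∀ s (hs : s ∈ Icc (0 : ℝ) T), ∃ hK : MemLp (K s) 2 (lebT T),
      (hL s hs).toLp (X s) = wienerIntegral hW (hK.toLp (K s)) := fun s hs => by
    obtain ⟨hK, h⟩ := hX.representation s hs
    exact ⟨hK, Lp.ext ((hL s hs).coeFn_toLp.trans h)⟩
  have hce := condExp_ae_eq_starProjection hG (hX.measurable t ht)
    (fun s => hX.measurable s (hD s.2)) (hX.centered t ht) (fun s => hX.centered s (hD s.2))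
    (hL t ht) (fun s => hL s (hD s.2)) (iSup_subtype' : sigmaOf X D = _)
  set S := Submodule.span ℝ (range fun s : D => (hL s (hD s.2)).toLp (X s)) with hS
  obtain ⟨g, hg⟩ : S.topologicalClosure.starProjection ((hL t ht).toLp (X t)) ∈
      (wienerIntegral hW).range := by
    refine Submodule.topologicalClosure_minimal _ ?_ (isClosed_range_wienerIntegral hW)
      (Submodule.starProjection_apply_mem _ _)
    rw [hS, Submodule.span_le]
    rintro _ ⟨s, rfl⟩
    obtain ⟨hK, h⟩ := hrep s (hD s.2)
    exact ⟨_, h.symm⟩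
  refine ⟨g, Lp.memLp g, ?_, fun u hu => ?_⟩
  · rw [Lp.toLp_coeFn]
    exact hce.trans (by rw [← hg]; rfl)
  · obtain ⟨hKu, h1⟩ := hrep u (hD hu)
    obtain ⟨hKt, h2⟩ := hrep t ht
    -- The residual is orthogonal to `X u`; the isometry transports this relation to the kernels in
    -- `L²([0,T])`.
    have h3 := Submodule.starProjection_inner_eq_zero (K := S.topologicalClosure)
      ((hL t ht).toLp (X t)) ((hL u (hD hu)).toLp (X u))
      (Submodule.le_topologicalClosure _ (Submodule.subset_span ⟨⟨u, hu⟩, rfl⟩))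
    rw [← hg, h1, h2] at h3
    change inner ℝ (_ - wienerIntegral hW g) _ = (0 : ℝ) at h3
    rw [← map_sub, inner_wienerIntegral, ← Lp.toLp_coeFn g (Lp.memLp g), ← MemLp.toLp_sub,
      inner_toLp] at h3
    simpa using h3

/-- For a Volterra kernel, integrating against `K u` over `[0,T]` is integrating over `[0,u]`. -/
theorem IsVolterraKernel.integral_mul_eq {T : ℝ} {K : ℝ → ℝ → ℝ} (hK : IsVolterraKernel T K)
    {u : ℝ} (hu : u ∈ Icc 0 T) (g : ℝ → ℝ) :
    ∫ s, g s * K u s ∂(lebT T) = ∫ s in (0 : ℝ)..u, g s * K u s := by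
  rw [lebT, integral_Icc_eq_integral_Ioc, intervalIntegral.integral_of_le hu.1]
  refine (setIntegral_eq_of_subset_of_forall_sdiff_eq_zero measurableSet_Ioc
    (Ioc_subset_Ioc_right hu.2) fun s hs => ?_)
  have : u < s := not_le.1 fun h => hs.2 ⟨hs.1.1, h⟩
  rw [hK u hu s ⟨hs.1.1.le, hs.1.2⟩ this, mul_zero]

end VolterraPrediction

/-! ### The Volterra system -/

theorem mainTheorem3 {Ω : Type*} [mΩ : MeasurableSpace Ω] (P : Measure Ω)
    [IsProbabilityMeasure P] (T : ℝ) (X W : ℝ → Ω → ℝ) (K : ℝ → ℝ → ℝ)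
    (hW : VolterraPrediction.IsBrownianMotionOn T W P)
    (hX : VolterraPrediction.IsFredholmGaussian T X W K P hW)
    (hK : VolterraPrediction.IsVolterraKernel T K)
    (n : ℕ) (tL tU : ℕ → ℝ) (hgrid : VolterraPrediction.IsObservationGrid T n tL tU)
    (t : ℝ) (ht : t ∈ Icc 0 T \ VolterraPrediction.observedSet n tL tU) :
    ∃ (f : ℝ → ℝ) (hf : MemLp f 2 (VolterraPrediction.lebT T)),
      P[X t | VolterraPrediction.sigmaOf X (VolterraPrediction.observedSet n tL tU)]
        =ᵐ[P] VolterraPrediction.wienerIntegral hW (hf.toLp f) ∧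
      ∀ k ∈ Finset.Icc 1 n,
        (∀ u ∈ Icc (tL k) (tU k),
          ∫ s in (tL k)..u, (f s - K t s) * K u s =
            ∫ s in (0 : ℝ)..(tL k), (K t s - f s) * K u s) ∧
        ∫ s in (tU (k - 1))..(tL k), f s * K (tL k) s =
          (∫ s in (0 : ℝ)..(tL k), K t s * K (tL k) s) -
            ∫ s in (0 : ℝ)..(tU (k - 1)), f s * K (tL k) s := by
  have hsub := hgrid.observedSet_subset
  obtain ⟨f, hf, hcond, horth⟩ := hX.exists_condExp_eq_wienerIntegral hsub ht.1
  refine ⟨f, hf, hcond, fun k hk => ?_⟩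
  have hLU := (hgrid.tL_lt_tU k hk).le
  have hmem : ∀ u ∈ Icc (tL k) (tU k), u ∈ VolterraPrediction.observedSet n tL tU :=
    fun u hu => mem_iUnion₂.2 ⟨k, hk, hu⟩
  have hLmem := hsub (hmem (tL k) ⟨le_rfl, hLU⟩)
  have hUmem : tU (k - 1) ∈ Icc 0 T :=
    ⟨hgrid.zero_le_tU _ (by have := Finset.mem_Icc.1 hk; omega),
      (hgrid.tU_pred_le_tL hk).trans hLmem.2⟩
  have h0mem : (0 : ℝ) ∈ Icc 0 T := ⟨le_rfl, ht.1.1.trans ht.1.2⟩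
  obtain ⟨hKt, -⟩ := hX.representation t ht.1
  have hzero : ∀ u ∈ Icc (tL k) (tU k), ∫ s in (0 : ℝ)..u, (K t s - f s) * K u s = 0 :=
    fun u hu => by
      rw [← hK.integral_mul_eq (hsub (hmem u hu)) fun s => K t s - f s, horth u (hmem u hu)]
  have hint : ∀ (g : ℝ → ℝ), MemLp g 2 (VolterraPrediction.lebT T) → ∀ u ∈ Icc 0 T,
      ∀ a ∈ Icc 0 T, ∀ b ∈ Icc 0 T,
      IntervalIntegrable (fun s => g s * K u s) volume a b := by
    intro g hg u hu a ha b hb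
    obtain ⟨hKu, -⟩ := hX.representation u hu
    -- A product of two `L²` functions is integrable, which licenses all the splittings of integrals
    -- below.
    have h : IntegrableOn (fun s => g s * K u s) (Icc 0 T) volume := hg.integrable_mul hKu
    exact (h.mono_set (uIcc_subset_Icc ha hb)).intervalIntegrable
  constructor
  · intro u hu
    have huT := hsub (hmem u hu)
    have h1 := intervalIntegral.integral_add_adjacent_intervals
      (hint _ (hKt.sub hf) u huT 0 h0mem (tL k) hLmem)
      (hint _ (hKt.sub hf) u huT (tL k) hLmem u huT)
    simp only [Pi.sub_apply] at h1
    rw [hzero u hu] at h1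
    have h2 : ∫ s in (tL k)..u, (f s - K t s) * K u s =
        -∫ s in (tL k)..u, (K t s - f s) * K u s := by
      rw [← intervalIntegral.integral_neg]
      exact intervalIntegral.integral_congr fun s _ => by ring
    linarith
  -- The boundary condition is the orthogonality relation at the left endpoint `u = tL k`, with the
  -- integral of `f` split at `tU (k - 1)`.
  · have h1 := hzero (tL k) ⟨le_rfl, hLU⟩
    simp only [sub_mul] at h1
    rw [intervalIntegral.integral_sub (hint _ hKt _ hLmem _ h0mem _ hLmem)
      (hint _ hf _ hLmem _ h0mem _ hLmem)] at h1
    have h2 := intervalIntegral.integral_add_adjacent_intervals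
      (hint _ hf _ hLmem 0 h0mem _ hUmem) (hint _ hf _ hLmem _ hUmem _ hLmem)
    linarith
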